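/- \textbf{Theorem (Generalized Shelah Theorem).} A \emph{covering} is a surjective map $p:\tilde X\to X$ such that every point of $X$ has an open neighbourhood evenly covered by $p$. A \emph{(categorical) universal covering} of $X$ is a covering $p:\tilde X\to X$ with $\tilde X$ path connected such that for every covering $q:\tilde Y\to X$ with $\tilde Y$ path connected there exists a covering $f:\tilde X\to\tilde Y$ with $q\circ f=p$, and $f$ is unique up to equivalence: if $f_1,f_2:\tilde X\to\tilde Y$ are two such coverings, then there is a homeomorphism $h:\tilde X\to\tilde X$ with $f_2\circ h=f_1$. Let $X$ be a connected, locally path connected and first countable topological space, and let $x\in X$. Then $X$ has a categorical universal covering, or the fundamental group $\pi_1(X,x)$ is uncountable. -/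

import Mathlib

universe u v w w'

/-- A covering `p : E → X`: a surjective map all of whose points have evenly covered neighbourhoods.
(Mathlib's `IsCoveringMap` allows empty fibres, so surjectivity is added.) -/
def IsCovering {E : Type w} {X : Type u} [TopologicalSpace E] [TopologicalSpace X]
    (p : E → X) : Prop :=
  IsCoveringMap p ∧ Function.Surjective p

/-- Two maps `f₁ : E₁ → Y`, `f₂ : E₂ → Y` (in practice coverings) are equivalent if there is
a homeomorphism `E₁ ≃ₜ E₂` over `Y`. -/
def CoveringEquivalent {E₁ : Type w} {E₂ : Type w'} {Y : Type v}
    [TopologicalSpace E₁] [TopologicalSpace E₂]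
    (f₁ : E₁ → Y) (f₂ : E₂ → Y) : Prop :=
  ∃ h : E₁ ≃ₜ E₂, f₂ ∘ h = f₁

/-- A categorical universal covering: a covering `p : E → X` with `E` path connected such that for
every covering `q : Y → X` with `Y` path connected there is a covering `f : E → Y` with `q ∘ f = p`,
unique up to equivalence of coverings of `Y`. -/
def IsUniversalCovering {E : Type w} {X : Type u} [TopologicalSpace E] [TopologicalSpace X]
    (p : E → X) : Prop :=
  IsCovering p ∧ PathConnectedSpace E ∧
    ∀ (Y : Type v) [TopologicalSpace Y] [PathConnectedSpace Y] (q : Y → X), IsCovering q →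
      (∃ f : E → Y, IsCovering f ∧ q ∘ f = p) ∧
      (∀ f₁ f₂ : E → Y, IsCovering f₁ → IsCovering f₂ → q ∘ f₁ = p → q ∘ f₂ = p →
        CoveringEquivalent f₁ f₂)

/-- `X` has a categorical universal covering. The competing coverings range over an arbitrary
universe `v`. -/
def HasUniversalCovering (X : Type u) [TopologicalSpace X] : Prop :=
  ∃ (E : Type u) (_ : TopologicalSpace E) (p : E → X), IsUniversalCovering.{u, v, u} p

/-! Call a congruence on the fundamental groupoid open if small loops at each point are trivial
modulo it. Every covering gives an open one, equality of monodromy, and every open one gives a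
covering by paths from `x₀` modulo it. So the `core`, the intersection of all open congruences,
decides the matter.

If the core is open, its covering maps onto every path connected covering, because the core refines
every monodromy congruence. Being a congruence on both sides, it also admits left translation by
loops, and these deck transformations give uniqueness.

If the core is not open, some point has, in each neighbourhood, a loop nontrivial modulo some open
congruence. Pick such loops `γₙ` and congruences `rₙ` recursively, with all later loops so small
that they are trivial modulo `rₙ`. Each binary sequence selects a subsequence to concatenate. At the
first disagreement `n`, cancel the common prefix: modulo `rₙ` one remainder is `γₙ`, the other
trivial. Hence `2^ℕ` injects into the fundamental group. -/

open Set Filter Topology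

/-! ### Infinite concatenation of loops -/

namespace InfiniteConcat

variable {X : Type*} [TopologicalSpace X] {x : X}

/-- The concatenation of the first `n` loops of a sequence, with the dyadic parametrisation. -/
noncomputable def partialConcat : ℕ → (ℕ → Path x x) → Path x x
  | 0, _ => Path.refl x
  | n + 1, β => (β 0).trans (partialConcat n fun k => β (k + 1))

/-- Loops of index at least `k` run only after time `1 - 2⁻ᵏ`, so the pointwise limit is eventually
constant at each time before `1`. -/
theorem partialConcat_stable (k : ℕ) (β : ℕ → Path x x) (t : unitInterval) (ht : (t : ℝ) ≤ 1 - (1 / 2) ^ k)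
    (m : ℕ) : partialConcat (k + m) β t = partialConcat k β t := by
  induction k generalizing β t with
  | zero =>
    have : t = 0 := le_antisymm (Subtype.coe_le_coe.1 (by simpa using ht)) t.2.1
    simp [this]
  | succ k ih =>
    rw [Nat.add_right_comm, partialConcat, partialConcat, Path.trans_apply, Path.trans_apply]
    split_ifs with h
    · rfl
    · refine ih _ _ ?_
      rw [pow_succ] at ht
      simp only
      linarith

theorem partialConcat_mem {T : Set X} {β : ℕ → Path x x} (k : ℕ) (hx : x ∈ T)
    (hβ : ∀ j ≥ k, range (β j) ⊆ T) (n : ℕ) (t : unitInterval) (ht : 1 - (1 / 2) ^ k ≤ (t : ℝ)) :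
    partialConcat n β t ∈ T := by
  induction n generalizing k β t with
  | zero => simpa [partialConcat] using hx
  | succ n ih =>
    rw [partialConcat, Path.trans_apply]
    cases k with
    | zero =>
      split_ifs with h
      · exact hβ 0 le_rfl (mem_range_self _)
      · exact ih 0 (fun j _ => hβ _ (Nat.zero_le _)) _ (by simp; linarith)
    | succ k =>
      have hk : ((1 : ℝ) / 2) ^ k ≤ 1 := pow_le_one₀ (by norm_num) (by norm_num)
      rw [pow_succ] at ht
      split_ifs with h
      -- Nothing is known about `β 0` here, but the bounds force `t = 1/2`, where its value is its
      -- endpoint.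
      · have h1 : (⟨2 * t, (unitInterval.mul_pos_mem_iff zero_lt_two).2 ⟨t.2.1, h⟩⟩ : unitInterval) = 1 :=
          Subtype.ext (by simp; linarith)
        rw [h1, Path.target]
        exact hx
      · exact ih k (fun j hj => hβ _ (Nat.succ_le_succ hj)) _ (by simp only; linarith)

theorem exists_le_one_sub {t : ℝ} (ht : t < 1) : ∃ k : ℕ, t < 1 - (1 / 2) ^ k := by
  obtain ⟨k, hk⟩ := exists_pow_lt_of_lt_one (sub_pos.2 ht) (by norm_num : (1 / 2 : ℝ) < 1)
  exact ⟨k, by linarith⟩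

theorem exists_eventually_eq (β : ℕ → Path x x) (t : unitInterval) :
    ∃ v, ∀ᶠ n in atTop, partialConcat n β t = v := by
  rcases eq_or_lt_of_le t.2.2 with h | h
  · obtain rfl : t = 1 := Subtype.ext h
    exact ⟨x, by simp⟩
  · obtain ⟨k, hk⟩ := exists_le_one_sub h
    refine ⟨partialConcat k β t, eventually_atTop.2 ⟨k, fun n hn => ?_⟩⟩
    obtain ⟨m, rfl⟩ := Nat.exists_eq_add_of_le hn
    exact partialConcat_stable k β t hk.le m

/-- The pointwise limit of the finite concatenations. -/
noncomputable def concatFun (β : ℕ → Path x x) (t : unitInterval) : X := (exists_eventually_eq β t).choose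

theorem eventually_concatFun (β : ℕ → Path x x) (t : unitInterval) :
    ∀ᶠ n in atTop, partialConcat n β t = concatFun β t := (exists_eventually_eq β t).choose_spec

theorem concatFun_eq (k : ℕ) (β : ℕ → Path x x) (t : unitInterval) (ht : (t : ℝ) ≤ 1 - (1 / 2) ^ k) :
    concatFun β t = partialConcat k β t := by
  obtain ⟨n, hn, hk⟩ := ((eventually_concatFun β t).and (eventually_ge_atTop k)).exists
  obtain ⟨m, rfl⟩ := Nat.exists_eq_add_of_le hk
  rw [← hn, partialConcat_stable k β t ht]

theorem concatFun_mem {T : Set X} {β : ℕ → Path x x} (k : ℕ) (hx : x ∈ T)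
    (hβ : ∀ j ≥ k, range (β j) ⊆ T) (t : unitInterval) (ht : 1 - (1 / 2) ^ k ≤ (t : ℝ)) :
    concatFun β t ∈ T := by
  obtain ⟨n, hn⟩ := (eventually_concatFun β t).exists
  exact hn ▸ partialConcat_mem k hx hβ n t ht

theorem concatFun_zero (β : ℕ → Path x x) : concatFun β 0 = x := by
  obtain ⟨n, hn⟩ := (eventually_concatFun β 0).exists
  simpa using hn.symm

theorem concatFun_one (β : ℕ → Path x x) : concatFun β 1 = x := by
  obtain ⟨n, hn⟩ := (eventually_concatFun β 1).exists
  simpa using hn.symm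

/-- A sequence of loops at `x` is null if its terms are eventually in every neighbourhood of `x`. -/
def IsNullSequence (β : ℕ → Path x x) : Prop :=
  ∀ T ∈ 𝓝 x, ∃ N, ∀ n ≥ N, range (β n) ⊆ T

theorem IsNullSequence.shift {β : ℕ → Path x x} (h : IsNullSequence β) :
    IsNullSequence fun k => β (k + 1) := fun T hT => by
  obtain ⟨N, hN⟩ := h T hT
  exact ⟨N, fun n hn => hN _ (by lia)⟩

theorem continuous_concatFun {β : ℕ → Path x x} (h : IsNullSequence β) :
    Continuous (concatFun β) := by
  refine continuous_iff_continuousAt.2 fun t => ?_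
  rcases eq_or_lt_of_le t.2.2 with ht | ht
  · obtain rfl : t = 1 := Subtype.ext ht
    intro T hT
    rw [concatFun_one] at hT
    rw [mem_map]
    obtain ⟨N, hN⟩ := h T hT
    have : {s : unitInterval | 1 - (1 / 2) ^ N < (s : ℝ)} ∈ 𝓝 (1 : unitInterval) :=
      (isOpen_lt continuous_const continuous_subtype_val).mem_nhds (by simp)
    filter_upwards [this] with s hs
    exact concatFun_mem N (mem_of_mem_nhds hT) hN s (le_of_lt hs)
  · obtain ⟨k, hk⟩ := exists_le_one_sub ht
    have : {s : unitInterval | (s : ℝ) < 1 - (1 / 2) ^ k} ∈ 𝓝 t :=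
      (isOpen_lt continuous_subtype_val continuous_const).mem_nhds hk
    refine ((partialConcat k β).continuous.continuousAt).congr ?_
    filter_upwards [this] with s hs
    exact (concatFun_eq k β s (le_of_lt hs)).symm

/-- The infinite concatenation of a null sequence of loops. -/
noncomputable def concat (β : ℕ → Path x x) (h : IsNullSequence β) : Path x x where
  toFun := concatFun β
  continuous_toFun := continuous_concatFun h
  source' := concatFun_zero β
  target' := concatFun_one β

/-- The dyadic parametrisation makes this an equality of paths, with no homotopy needed; it allows
loops to be peeled off one at a time. -/
theorem concat_eq_trans (β : ℕ → Path x x) (h : IsNullSequence β) :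
    concat β h = (β 0).trans (concat (fun k => β (k + 1)) h.shift) := by
  ext t
  change concatFun β t = _
  rw [Path.trans_apply]
  have h1 := (tendsto_add_atTop_nat 1).eventually (eventually_concatFun β t)
  split_ifs with ht
  · obtain ⟨n, hn⟩ := h1.exists
    rw [← hn, partialConcat, Path.trans_apply, dif_pos ht]
  · obtain ⟨n, hn, hn'⟩ := (h1.and (eventually_concatFun (fun k => β (k + 1))
      ⟨2 * t - 1, unitInterval.two_mul_sub_one_mem_iff.2 ⟨(not_le.1 ht).le, t.2.2⟩⟩)).exists
    rw [← hn, partialConcat, Path.trans_apply, dif_neg ht]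
    exact hn'

theorem range_concat_subset {T : Set X} {β : ℕ → Path x x} (h : IsNullSequence β)
    (hβ : ∀ j, range (β j) ⊆ T) : range (concat β h) ⊆ T := by
  rintro _ ⟨t, rfl⟩
  exact concatFun_mem 0 (hβ 0 ⟨0, (β 0).source⟩) (fun j _ => hβ j) t (by simpa using t.2.1)

end InfiniteConcat

/-! ### Congruences on homotopy classes of paths -/

/-- A congruence on the fundamental groupoid of `X`. -/
structure PathCongruence (X : Type*) [TopologicalSpace X] where
  ofRel ::
  /-- The underlying relation on homotopy classes of paths with common endpoints. -/
  rel : ∀ {x y : X}, Path.Homotopic.Quotient x y → Path.Homotopic.Quotient x y → Prop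
  refl : ∀ {x y : X} (a : Path.Homotopic.Quotient x y), rel a a
  symm : ∀ {x y : X} {a b : Path.Homotopic.Quotient x y}, rel a b → rel b a
  trans : ∀ {x y : X} {a b c : Path.Homotopic.Quotient x y}, rel a b → rel b c → rel a c
  comp : ∀ {x y z : X} {a a' : Path.Homotopic.Quotient x y} {b b' : Path.Homotopic.Quotient y z},
    rel a a' → rel b b' → rel (a.trans b) (a'.trans b')

namespace PathCongruence

open Path.Homotopic.Quotient InfiniteConcat

variable {X : Type*} [TopologicalSpace X]

/-- Every point has a neighbourhood in which all loops at that point are trivial. -/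
def IsOpen (r : PathCongruence X) : Prop :=
  ∀ x, ∃ U ∈ 𝓝 x, ∀ γ : Path x x, range γ ⊆ U → r.rel (mk γ) (.refl x)

variable (X) in
/-- The intersection of all open congruences. -/
def core : PathCongruence X where
  rel a b := ∀ r : PathCongruence X, r.IsOpen → r.rel a b
  refl a r _ := r.refl a
  symm h r hr := r.symm (h r hr)
  trans h h' r hr := r.trans (h r hr) (h' r hr)
  comp h h' r hr := r.comp (h r hr) (h' r hr)

theorem trans_left_cancel {x y z : X} {a : Path.Homotopic.Quotient x y}
    {b c : Path.Homotopic.Quotient y z} (h : a.trans b = a.trans c) : b = c := by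
  have := congrArg (a.symm.trans ·) h
  simpa [← trans_assoc] using this

theorem exists_uncountable_of_not_isOpen_core [FirstCountableTopology X]
    (h : ¬ (core X).IsOpen) : ∃ x : X, Uncountable (FundamentalGroup X x) := by
  simp only [IsOpen, not_forall, not_exists, not_and] at h
  obtain ⟨x, hx⟩ := h
  have key : ∀ U : {U // U ∈ 𝓝 x}, ∃ γ : Path x x, range γ ⊆ U.1 ∧ ∃ r : PathCongruence X,
      ¬ r.rel (mk γ) (.refl x) ∧ ∃ W ∈ 𝓝 x, ∀ δ : Path x x, range δ ⊆ W →
        r.rel (mk δ) (.refl x) := by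
    rintro ⟨U, hU⟩
    obtain ⟨γ, hγ, hc⟩ := hx U hU
    simp only [core, not_forall] at hc
    obtain ⟨r, hr, hrγ⟩ := hc
    exact ⟨γ, hγ, r, hrγ, hr x⟩
  choose γ hγ r hr W hW hrW using key
  obtain ⟨B, hB⟩ := (𝓝 x).exists_antitone_basis
  -- Intersecting with `W V` makes all later loops trivial modulo the current congruence;
  -- intersecting with `B (n + 1)` makes the loops a null sequence.
  let V : ℕ → {U // U ∈ 𝓝 x} := fun n => Nat.rec ⟨B 0, hB.1.mem_of_mem trivial⟩
    (fun n V => ⟨V.1 ∩ W V ∩ B (n + 1),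
      inter_mem (inter_mem V.2 (hW V)) (hB.1.mem_of_mem trivial)⟩) n
  have hV : ∀ n, (V (n + 1)).1 = (V n).1 ∩ W (V n) ∩ B (n + 1) := fun n => rfl
  have hVanti : Antitone fun n => (V n).1 :=
    antitone_nat_of_succ_le fun n => (hV n).le.trans (inter_subset_left.trans inter_subset_left)
  have hVB : ∀ n, (V n).1 ⊆ B n := by
    rintro (_ | n)
    · exact subset_rfl
    · exact (hV n).le.trans inter_subset_right
  let β (ε : ℕ → Bool) (n : ℕ) : Path x x := if ε n then γ (V n) else Path.refl x
  have hβ : ∀ ε n, range (β ε n) ⊆ (V n).1 := by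
    intro ε n
    simp only [β]
    split_ifs
    · exact hγ _
    · simpa using mem_of_mem_nhds (V n).2
  have hnull : ∀ ε m, IsNullSequence fun k => β ε (k + m) := fun ε m T hT => by
    obtain ⟨N, -, hN⟩ := hB.1.mem_iff.1 hT
    exact ⟨N, fun n hn => (hβ ε _).trans ((hVanti (by lia : N ≤ n + m)).trans
      ((hVB N).trans hN))⟩
  let K (ε : ℕ → Bool) (n : ℕ) : Path x x := concat _ (hnull ε n)
  have hK : ∀ ε n, mk (K ε n) = (mk (β ε n)).trans (mk (K ε (n + 1))) := by
    intro ε n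
    rw [← mk_trans]
    refine congrArg mk ((concat_eq_trans _ _).trans ?_)
    simp only [Nat.zero_add, K]
    congr! 4
    lia
  have htail : ∀ ε n, (r (V n)).rel (mk (K ε (n + 1))) (.refl x) := fun ε n =>
    hrW _ _ (range_concat_subset _ fun j => (hβ ε _).trans
      ((hVanti (by lia : n + 1 ≤ j + (n + 1))).trans
        ((hV n).le.trans (inter_subset_left.trans inter_subset_right))))
  have hagree : ∀ ε ε' : ℕ → Bool, mk (K ε 0) = mk (K ε' 0) → ∀ n, (∀ k < n, ε k = ε' k) →
      mk (K ε n) = mk (K ε' n) := by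
    intro ε ε' h0 n
    induction n with
    | zero => exact fun _ => h0
    | succ n ih =>
      intro hn
      have h1 := ih fun k hk => hn k (by lia)
      rw [hK ε, hK ε'] at h1
      have h2 : β ε n = β ε' n := by simp only [β, hn n (by lia)]
      rw [h2] at h1
      exact trans_left_cancel h1
  have hne : ∀ (ε ε' : ℕ → Bool) n, ε n = true → ε' n = false → mk (K ε n) ≠ mk (K ε' n) := by
    intro ε ε' n h1 h2 h3
    rw [hK ε, hK ε'] at h3
    simp only [β, h1, h2, if_true, Bool.false_eq_true, if_false, mk_refl, refl_trans] at h3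
    refine hr (V n) ?_
    have h4 := (r (V n)).comp ((r (V n)).refl (mk (γ (V n)))) (htail ε n)
    rw [h3, trans_refl] at h4
    exact (r (V n)).trans ((r (V n)).symm h4) (htail ε' n)
  have hinj : Function.Injective fun ε : ℕ → Bool => FundamentalGroup.fromPath (mk (K ε 0)) := by
    intro ε ε' h0
    by_contra hεε'
    have hex : ∃ n, ε n ≠ ε' n := Function.ne_iff.1 hεε'
    classical
    have h1 := hagree ε ε' h0 (Nat.find hex) fun k hk => not_not.1 (Nat.find_min hex hk)
    have h2 := Nat.find_spec hex
    cases h3 : ε (Nat.find hex) <;> cases h4 : ε' (Nat.find hex)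
    · simp [h3, h4] at h2
    · exact hne ε' ε _ h4 h3 h1.symm
    · exact hne ε ε' _ h3 h4 h1
    · simp [h3, h4] at h2
  have : Uncountable (ℕ → Bool) := by
    rw [← Cardinal.aleph0_lt_mk_iff]
    simpa using Cardinal.cantor Cardinal.aleph0
  exact ⟨x, hinj.uncountable⟩

end PathCongruence


/-! ### Criteria for covering maps -/

/-- A continuous open surjection is evenly covered over an open set `U` over which its total space
splits into disjoint open slices mapped bijectively to `U`. -/
theorem isEvenlyCovered_of_slices {E X ι : Type*} [TopologicalSpace E] [TopologicalSpace X]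
    {f : E → X} (hf : Continuous f) (ho : IsOpenMap f) (hsurj : Function.Surjective f) {x : X}
    {U : Set X} (hU : IsOpen U) (hx : x ∈ U) (S : ι → Set E) (hS : ∀ i, IsOpen (S i))
    (inj : ∀ i, (S i).InjOn f) (surj : ∀ i, (S i).SurjOn f U)
    (disj : Pairwise (Function.onFun Disjoint S)) (cover : f ⁻¹' U ⊆ ⋃ i, S i) :
    IsEvenlyCovered f x (f ⁻¹' {x}) := by
  obtain ⟨e, he⟩ := hsurj x
  obtain ⟨i, -⟩ := mem_iUnion.1 (cover (show f e ∈ U from he ▸ hx))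
  have : Nonempty ι := ⟨i⟩
  have : Nonempty (X → E) := ⟨fun _ => e⟩
  let _ : TopologicalSpace ι := ⊥
  have : DiscreteTopology ι := ⟨rfl⟩
  refine (IsEvenlyCovered.of_trivialization (I := ι)
    (t := IsOpen.trivializationDiscrete S U hU ?_ inj surj disj cover) hx).to_isEvenlyCovered_preimage
  intro i W hW
  refine ⟨fun h => (h.preimage hf).inter (hS i), fun h => ?_⟩
  convert ho _ h
  ext w
  constructor
  · intro hw
    obtain ⟨e, he, rfl⟩ := surj i (hW hw)
    exact ⟨e, ⟨hw, he⟩, rfl⟩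
  · rintro ⟨e, ⟨hw, -⟩, rfl⟩
    exact hw

/-- Fix the sheet coordinate in a trivialization. Allowing every open `V ⊆ U` lets two coverings be
compared over one connected set. -/
theorem IsCoveringMap.exists_section {E X : Type*} [TopologicalSpace E] [TopologicalSpace X]
    {p : E → X} (hp : IsCoveringMap p) (x : X) :
    ∃ U, IsOpen U ∧ x ∈ U ∧ ∀ V ⊆ U, IsOpen V → ∀ e, p e ∈ V → ∃ s : X → E,
      ContinuousOn s V ∧ (∀ v ∈ V, p (s v) = v) ∧ s (p e) = e ∧ IsOpen (s '' V) := by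
  by_cases hne : Nonempty (p ⁻¹' {x})
  · let t := (hp x).toTrivialization
    have := (hp x).1
    refine ⟨t.baseSet, t.open_baseSet, (hp x).mem_toTrivialization_baseSet, ?_⟩
    intro V hV hVo e he
    refine ⟨fun v => t.toOpenPartialHomeomorph.symm (v, (t e).2), ?_, fun v hv =>
      t.proj_symm_apply' (hV hv), t.symm_apply_mk_proj (t.mem_source.2 (hV he)), ?_⟩
    · refine t.toOpenPartialHomeomorph.continuousOn_symm.comp (by fun_prop) fun v hv => ?_
      exact t.mem_target.2 (hV hv)
    · have h1 : (fun v => t.toOpenPartialHomeomorph.symm (v, (t e).2)) '' V =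
          t.toOpenPartialHomeomorph.symm '' (V ×ˢ {(t e).2}) := by
        rw [prod_singleton, image_image]
      rw [h1]
      refine t.toOpenPartialHomeomorph.isOpen_image_symm_of_subset_target
        (hVo.prod (isOpen_discrete _)) fun v hv => t.mem_target.2 (hV hv.1)
  · obtain ⟨-, U, hxU, hU, -, H, -⟩ := hp x
    refine ⟨U, hU, hxU, fun V hV _ e he => ?_⟩
    exact (hne ⟨(H ⟨e, hV he⟩).2⟩).elim

/-- If `q` and `q ∘ f` are covering maps over a locally connected space, then so is `f`, provided
that it is continuous and surjective. -/
theorem IsCoveringMap.of_comp {E Y X : Type*} [TopologicalSpace E] [TopologicalSpace Y]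
    [TopologicalSpace X] [LocallyConnectedSpace X] {f : E → Y} {q : Y → X} (hq : IsCoveringMap q)
    (hqf : IsCoveringMap (q ∘ f)) (hf : Continuous f) (hsurj : Function.Surjective f) :
    IsCoveringMap f := by
  intro y
  obtain ⟨U₁, hU₁, hx₁, h₁⟩ := hq.exists_section (q y)
  obtain ⟨U₂, hU₂, hx₂, h₂⟩ := hqf.exists_section (q y)
  obtain ⟨U, hU, ⟨hUo, hxU, hUc⟩⟩ := locallyConnectedSpace_iff_subsets_isOpen_isConnected.1
    ‹_› (q y) (U₁ ∩ U₂) (inter_mem (hU₁.mem_nhds hx₁) (hU₂.mem_nhds hx₂))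
  obtain ⟨τ, hτ, hqτ, hτy, hτo⟩ := h₁ U (hU.trans inter_subset_left) hUo y hxU
  choose s hs hps hse hso using fun e : f ⁻¹' {y} =>
    h₂ U (hU.trans inter_subset_right) hUo e.1 (by simpa [show f e = y from e.2] using hxU)
  have hsy : ∀ e : f ⁻¹' {y}, s e (q y) = e := fun e => by
    have := hse e
    rwa [Function.comp_apply, show f e = y from e.2] at this
  have hfs : ∀ (e : f ⁻¹' {y}) u, u ∈ U → f (s e u) = τ u := fun e u hu =>
    hq.eqOn_of_comp_eqOn hUc.isPreconnected (hf.comp_continuousOn (hs e)) hτ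
      (fun v hv => (hps e v hv).trans (hqτ v hv).symm) hxU
      (by rw [Function.comp_apply, hsy, hτy]; exact e.2) hu
  -- The sheets over `τ '' U` are the sections of `q ∘ f` through the points of the fibre of `f`
  -- over `y`; unique lifting over the connected `U` gives disjointness and covering.
  refine isEvenlyCovered_of_slices hf (hqf.isLocalHomeomorph.of_comp hq.isLocalHomeomorph
    hf).isOpenMap hsurj hτo ⟨q y, hxU, hτy⟩ (fun e => s e '' U) hso ?_ ?_ ?_ ?_
  · rintro e _ ⟨u, hu, rfl⟩ _ ⟨v, hv, rfl⟩ h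
    have := congrArg q h
    rw [← Function.comp_apply (f := q), ← Function.comp_apply (f := q), hps e u hu,
      hps e v hv] at this
    rw [this]
  · rintro e _ ⟨u, hu, rfl⟩
    exact ⟨s e u, mem_image_of_mem _ hu, hfs e u hu⟩
  · intro e e' hne
    refine disjoint_left.2 ?_
    rintro _ ⟨u, hu, rfl⟩ ⟨v, hv, h⟩
    have huv := congrArg (q ∘ f) h
    rw [hps e u hu, hps e' v hv] at huv
    subst huv
    refine hne (Subtype.ext ?_)
    rw [← hsy e, ← hsy e']
    exact hqf.eqOn_of_comp_eqOn hUc.isPreconnected (hs e) (hs e')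
      (fun w hw => (hps e w hw).trans (hps e' w hw).symm) hu h.symm hxU
  · rintro e ⟨u, hu, hue⟩
    have hpe : q (f e) = u := by rw [← hue, hqτ u hu]
    obtain ⟨ρ, hρ, hpρ, hρe, -⟩ := h₂ U (hU.trans inter_subset_right) hUo e
      (by rwa [Function.comp_apply, hpe])
    rw [Function.comp_apply, hpe] at hρe
    have hfρ : ∀ v ∈ U, f (ρ v) = τ v := fun v hv =>
      hq.eqOn_of_comp_eqOn hUc.isPreconnected (hf.comp_continuousOn hρ) hτ
        (fun w hw => (hpρ w hw).trans (hqτ w hw).symm) hu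
        (by rw [Function.comp_apply, hρe, hue]) hv
    have he' : f (ρ (q y)) = y := (hfρ _ hxU).trans hτy
    refine mem_iUnion.2 ⟨⟨ρ (q y), he'⟩, u, hu, ?_⟩
    rw [← hρe]
    exact hqf.eqOn_of_comp_eqOn hUc.isPreconnected (hs _) hρ
      (fun w hw => (hps _ w hw).trans (hpρ w hw).symm) hxU (hsy _) hu

/-- Monodromy along a path contained in the domain of a local section. -/
theorem IsCoveringMap.monodromy_section {E X : Type*} [TopologicalSpace E] [TopologicalSpace X]
    {p : E → X} (hp : IsCoveringMap p) {U : Set X} {s : X → E} (hs : ContinuousOn s U)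
    (hps : ∀ u ∈ U, p (s u) = u) {x y : X} (γ : Path x y) (hγ : range γ ⊆ U) (e : p ⁻¹' {x})
    (he : e.1 = s x) : (hp.monodromy (.mk γ) e).1 = s y := by
  have h := (hp.eq_liftPath_iff (γ := ⟨γ, γ.continuous⟩) (e := e.1)
    (γ.source.trans e.2.symm) (Γ := s ∘ γ)).2 ⟨hs.comp_continuous γ.continuous
      fun t => hγ (mem_range_self t), funext fun t => hps _ (hγ (mem_range_self t)),
      by rw [Function.comp_apply, γ.source, he]⟩
  refine (congrFun h 1).symm.trans ?_
  rw [Function.comp_apply, γ.target]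

/-! ### The covering space associated with an open congruence -/

namespace PathCongruence

open Path.Homotopic.Quotient

variable {X : Type*} [TopologicalSpace X]

theorem cancel_right (r : PathCongruence X) {x y z : X} {a b : Path.Homotopic.Quotient x y}
    {c : Path.Homotopic.Quotient y z} (h : r.rel (a.trans c) (b.trans c)) : r.rel a b := by
  have := r.comp h (r.refl c.symm)
  simpa using this

/-- Homotopy classes of paths starting at `x₀` modulo a congruence. -/
def Cover (r : PathCongruence X) (x₀ : X) := Σ y : X, Quot (r.rel (x := x₀) (y := y))

variable {r : PathCongruence X} {x₀ : X}

/-- The point of the covering space represented by a homotopy class of paths. -/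
def toCover (r : PathCongruence X) {x₀ y : X} (a : Path.Homotopic.Quotient x₀ y) : r.Cover x₀ :=
  ⟨y, Quot.mk _ a⟩

/-- The endpoint projection. -/
def proj (r : PathCongruence X) (x₀ : X) (e : r.Cover x₀) : X := e.1

@[simp]
theorem proj_toCover {y : X} (a : Path.Homotopic.Quotient x₀ y) :
    r.proj x₀ (r.toCover a) = y := rfl

theorem exists_toCover (e : r.Cover x₀) :
    ∃ (y : X) (a : Path.Homotopic.Quotient x₀ y), r.toCover a = e := by
  obtain ⟨y, ⟨a⟩⟩ := e
  exact ⟨y, a, rfl⟩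

theorem toCover_eq_iff {y : X} {a b : Path.Homotopic.Quotient x₀ y} :
    r.toCover a = r.toCover b ↔ r.rel a b := by
  constructor
  · intro heq
    have h := Quot.eqvGen_exact (eq_of_heq (Sigma.mk.inj heq).2)
    clear heq
    induction h with
    | rel _ _ h => exact h
    | refl a => exact r.refl a
    | symm _ _ _ h => exact r.symm h
    | trans _ _ _ _ _ h h' => exact r.trans h h'
  · exact fun h => congrArg (Sigma.mk y) (Quot.sound h)

/-- Open sets are those stable under appending sufficiently short paths. -/
instance : TopologicalSpace (r.Cover x₀) where
  IsOpen S := ∀ (y : X) (a : Path.Homotopic.Quotient x₀ y), r.toCover a ∈ S →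
    ∃ U ∈ 𝓝 y, ∀ (z : X) (δ : Path y z), range δ ⊆ U → r.toCover (a.trans (.mk δ)) ∈ S
  isOpen_univ _ _ _ := ⟨univ, univ_mem, fun _ _ _ => mem_univ _⟩
  isOpen_inter S T hS hT y a ha := by
    obtain ⟨U, hU, h⟩ := hS y a ha.1
    obtain ⟨V, hV, h'⟩ := hT y a ha.2
    exact ⟨U ∩ V, inter_mem hU hV, fun z δ hδ => ⟨h z δ (hδ.trans inter_subset_left),
      h' z δ (hδ.trans inter_subset_right)⟩⟩
  isOpen_sUnion 𝒮 h𝒮 y a := by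
    rintro ⟨S, hS, ha⟩
    obtain ⟨U, hU, h⟩ := h𝒮 S hS y a ha
    exact ⟨U, hU, fun z δ hδ => ⟨S, hS, h z δ hδ⟩⟩

theorem isOpen_cover_iff {S : Set (r.Cover x₀)} : _root_.IsOpen S ↔
    ∀ (y : X) (a : Path.Homotopic.Quotient x₀ y), r.toCover a ∈ S →
    ∃ U ∈ 𝓝 y, ∀ (z : X) (δ : Path y z), range δ ⊆ U → r.toCover (a.trans (.mk δ)) ∈ S := Iff.rfl

theorem continuous_proj : Continuous (r.proj x₀) :=
  ⟨fun V hV _ _ ha => ⟨V, hV.mem_nhds ha, fun _ δ hδ => hδ ⟨1, δ.target⟩⟩⟩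

theorem isOpenMap_proj [LocallyPathConnectedSpace X] : IsOpenMap (r.proj x₀) := by
  intro S hS
  refine isOpen_iff_mem_nhds.2 ?_
  rintro _ ⟨e, he, rfl⟩
  obtain ⟨y, a, rfl⟩ := exists_toCover e
  obtain ⟨U, hU, h⟩ := isOpen_cover_iff.1 hS y a he
  filter_upwards [pathComponentIn_mem_nhds hU] with z hz
  exact ⟨_, h z hz.somePath (range_subset_iff.2 hz.somePath_mem), rfl⟩

theorem surjective_proj [PathConnectedSpace X] : Function.Surjective (r.proj x₀) := fun y =>
  ⟨r.toCover (.mk (PathConnectedSpace.somePath x₀ y)), rfl⟩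

/-- The translates of a point of the covering space along paths in `U`. -/
def slice (r : PathCongruence X) {x₀ x : X} (U : Set X) (a : Path.Homotopic.Quotient x₀ x) :
    Set (r.Cover x₀) :=
  {e | ∃ (z : X) (δ : Path x z), range δ ⊆ U ∧ r.toCover (a.trans (.mk δ)) = e}

theorem isOpen_slice {x : X} {U : Set X} (hU : _root_.IsOpen U)
    (a : Path.Homotopic.Quotient x₀ x) : _root_.IsOpen (r.slice U a) := by
  rintro y b ⟨z, δ, hδ, h⟩
  obtain rfl : z = y := congrArg (r.proj x₀) h
  refine ⟨U, hU.mem_nhds (hδ ⟨1, δ.target⟩), fun w η hη => ⟨w, δ.trans η, ?_, ?_⟩⟩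
  · rw [Path.trans_range]
    exact union_subset hδ hη
  · rw [toCover_eq_iff, mk_trans, ← Path.Homotopic.Quotient.trans_assoc]
    exact r.comp (toCover_eq_iff.1 h) (r.refl _)

theorem rel_of_range_subset {x z : X} {U : Set X}
    (hU : ∀ γ : Path x x, range γ ⊆ U → r.rel (.mk γ) (.refl x)) {δ η : Path x z}
    (hδ : range δ ⊆ U) (hη : range η ⊆ U) : r.rel (.mk δ) (.mk η) := by
  have h := hU (δ.trans η.symm) (by
    rw [Path.trans_range, Path.symm_range]; exact union_subset hδ hη)
  refine r.cancel_right (c := (mk η).symm) ?_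
  simpa using h

/-- Over a small path connected `U`, sheets correspond to classes of paths ending at `x`. Openness
of `r` makes the choice of path inside `U` irrelevant. -/
theorem isCoveringMap_proj [LocallyPathConnectedSpace X] [PathConnectedSpace X] (hr : r.IsOpen) :
    IsCoveringMap (r.proj x₀) := by
  intro x
  obtain ⟨W, hW, hWr⟩ := hr x
  obtain ⟨U, ⟨hU, hxU, hUc⟩, hUW⟩ := (isOpen_isPathConnected_basis x).mem_iff.1 hW
  have hUr : ∀ γ : Path x x, range γ ⊆ U → r.rel (.mk γ) (.refl x) := fun γ hγ =>
    hWr γ (hγ.trans hUW)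
  refine isEvenlyCovered_of_slices (ι := Quot (r.rel (x := x₀) (y := x))) continuous_proj
    isOpenMap_proj surjective_proj hU hxU (fun i => r.slice U i.out) (fun i => isOpen_slice hU _)
    ?_ ?_ ?_ ?_
  · rintro i _ ⟨z, δ, hδ, rfl⟩ _ ⟨w, η, hη, rfl⟩ h
    obtain rfl : z = w := h
    exact toCover_eq_iff.2 (r.comp (r.refl _) (rel_of_range_subset hUr hδ hη))
  · intro i y hy
    obtain ⟨δ, hδ⟩ := hUc.joinedIn x hxU y hy
    exact ⟨_, ⟨y, δ, range_subset_iff.2 hδ, rfl⟩, rfl⟩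
  · intro i j hij
    refine disjoint_left.2 ?_
    rintro _ ⟨z, δ, hδ, rfl⟩ ⟨w, η, hη, h⟩
    obtain rfl : w = z := congrArg (r.proj x₀) h
    refine hij ?_
    rw [← Quot.out_eq i, ← Quot.out_eq j]
    refine Quot.sound (r.cancel_right (r.trans (r.symm (toCover_eq_iff.1 h)) ?_))
    exact r.comp (r.refl _) (rel_of_range_subset hUr hη hδ)
  · intro e he
    obtain ⟨y, b, rfl⟩ := exists_toCover e
    obtain ⟨δ, hδ⟩ := hUc.joinedIn x hxU y he
    refine mem_iUnion.2 ⟨Quot.mk _ (b.trans (mk δ).symm), y, δ, range_subset_iff.2 hδ, ?_⟩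
    rw [toCover_eq_iff]
    have h : r.toCover (Quot.mk r.rel (b.trans (mk δ).symm)).out =
        r.toCover (b.trans (mk δ).symm) := congrArg (Sigma.mk x) (Quot.out_eq _)
    simpa using r.comp (toCover_eq_iff.1 h) (r.refl (mk δ))

theorem toCover_congr {y z : X} {γ : Path x₀ y} {δ : Path x₀ z} (h : ∀ t, γ t = δ t) :
    r.toCover (.mk γ) = r.toCover (.mk δ) := by
  obtain rfl : y = z := by simpa using h 1
  obtain rfl : γ = δ := Path.ext (funext h)
  rfl

/-- The connecting path sends `t` to the class of the initial segment of `γ` up to `t`. -/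
theorem joined_toCover {y : X} (γ : Path x₀ y) :
    Joined (r.toCover (.refl x₀)) (r.toCover (.mk γ)) := by
  let Γ (t : unitInterval) : r.Cover x₀ :=
    r.toCover (.mk ((γ.subpath 0 t).cast γ.source.symm rfl))
  have hΓ : ∀ s t, Γ t = r.toCover
      ((mk ((γ.subpath 0 s).cast γ.source.symm rfl)).trans (mk (γ.subpath s t))) := by
    intro s t
    have h : mk ((γ.subpath 0 s).trans (γ.subpath s t)) = mk (γ.subpath 0 t) :=
      Path.Homotopic.Quotient.eq.2 ⟨Path.Homotopy.subpathTransSubpath γ 0 s t⟩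
    have h' := congrArg (fun c => r.toCover (c.cast γ.source.symm rfl)) h
    exact h'.symm
  have hc : Continuous Γ := by
    refine ⟨fun S hS => isOpen_iff_mem_nhds.2 fun s hs => ?_⟩
    obtain ⟨U, hU, h⟩ := isOpen_cover_iff.1 hS _ _ hs
    have hs' := (tendsto_const_nhds (x := s)).uIcc (tendsto_id (x := 𝓝 s))
    filter_upwards [hs'.eventually (eventually_smallSets_subset.2
      (γ.continuous.continuousAt hU))] with t ht
    rw [mem_preimage, hΓ s t]
    refine h _ _ ?_
    rw [Path.range_subpath, image_subset_iff]
    exact ht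
  refine ⟨⟨⟨Γ, hc⟩, ?_, ?_⟩⟩
  · refine toCover_congr (δ := Path.refl x₀) fun t => ?_
    simp
  · refine toCover_congr fun t => ?_
    simp

theorem pathConnectedSpace_cover (r : PathCongruence X) (x₀ : X) :
    PathConnectedSpace (r.Cover x₀) := by
  have h : ∀ e, Joined (r.toCover (.refl x₀)) e := fun e => by
    obtain ⟨y, a, rfl⟩ := exists_toCover e
    induction a using Path.Homotopic.Quotient.ind with
    | mk γ => exact joined_toCover γ
  exact ⟨⟨r.toCover (.refl x₀)⟩, fun e e' => (h e).symm.trans (h e')⟩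

/-! ### Deck transformations -/

theorem continuous_of_toCover {Y : Type*} [TopologicalSpace Y] {f : r.Cover x₀ → Y}
    (h : ∀ (y : X) (a : Path.Homotopic.Quotient x₀ y), ∀ T ∈ 𝓝 (f (r.toCover a)),
      ∃ U ∈ 𝓝 y, ∀ (z : X) (δ : Path y z), range δ ⊆ U →
        f (r.toCover (a.trans (.mk δ))) ∈ T) : Continuous f :=
  ⟨fun T hT y a ha => h y a T (hT.mem_nhds ha)⟩

/-- Left translation by a loop. -/
noncomputable def translate (r : PathCongruence X) {x₀ : X} (c : Path.Homotopic.Quotient x₀ x₀)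
    (e : r.Cover x₀) : r.Cover x₀ :=
  ⟨e.1, Quot.map (fun a => c.trans a) (fun _ _ h => r.comp (r.refl c) h) e.2⟩

@[simp]
theorem translate_toCover (c : Path.Homotopic.Quotient x₀ x₀) {y : X}
    (a : Path.Homotopic.Quotient x₀ y) :
    r.translate c (r.toCover a) = r.toCover (c.trans a) := rfl

theorem continuous_translate (c : Path.Homotopic.Quotient x₀ x₀) :
    Continuous (r.translate c) := by
  refine ⟨fun S hS y a ha => ?_⟩
  obtain ⟨U, hU, h⟩ := isOpen_cover_iff.1 hS y (c.trans a) ha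
  refine ⟨U, hU, fun z δ hδ => ?_⟩
  rw [mem_preimage, translate_toCover, ← Path.Homotopic.Quotient.trans_assoc]
  exact h z δ hδ

/-- The deck transformation given by a loop. -/
noncomputable def deck (r : PathCongruence X) {x₀ : X} (c : Path.Homotopic.Quotient x₀ x₀) :
    r.Cover x₀ ≃ₜ r.Cover x₀ where
  toFun := r.translate c
  invFun := r.translate c.symm
  left_inv e := by
    obtain ⟨y, a, rfl⟩ := exists_toCover e
    simp [← Path.Homotopic.Quotient.trans_assoc]
  right_inv e := by
    obtain ⟨y, a, rfl⟩ := exists_toCover e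
    simp [← Path.Homotopic.Quotient.trans_assoc]
  continuous_toFun := continuous_translate c
  continuous_invFun := continuous_translate c.symm

end PathCongruence

/-! ### Lifting along coverings -/

namespace IsCoveringMap

open Path.Homotopic.Quotient PathCongruence

variable {X Y : Type*} [TopologicalSpace X] [TopologicalSpace Y] {q : Y → X}

/-- Two homotopy classes of paths are congruent if they have the same monodromy. -/
def pathCongruence (hq : IsCoveringMap q) : PathCongruence X where
  rel a b := hq.monodromy a = hq.monodromy b
  refl _ := rfl
  symm h := h.symm
  trans h h' := h.trans h'
  comp h h' := by
    funext e
    rw [hq.monodromy_trans_apply, hq.monodromy_trans_apply, h, h']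

/-- The lift of a loop inside an evenly covered set stays in one sheet, so it closes up. -/
theorem isOpen_pathCongruence (hq : IsCoveringMap q) : hq.pathCongruence.IsOpen := by
  intro x
  obtain ⟨U, hU, hxU, h⟩ := hq.exists_section x
  refine ⟨U, hU.mem_nhds hxU, fun γ hγ => funext fun e => Subtype.ext ?_⟩
  have he : q e.1 = x := e.2
  obtain ⟨s, hs, hqs, hse, -⟩ := h U subset_rfl hU e.1 (by rwa [he])
  rw [he] at hse
  rw [hq.monodromy_section hs hqs γ hγ e hse.symm, hq.monodromy_refl, id, hse]

/-- The map to a covering space sending a class of paths to the endpoint of its lift. -/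
noncomputable def liftCover (hq : IsCoveringMap q) (y₀ : Y) (e : (core X).Cover (q y₀)) : Y :=
  Quot.lift (fun a => (hq.monodromy a ⟨y₀, rfl⟩).1)
    (fun _ _ h => congrArg (fun f => (f ⟨y₀, rfl⟩).1) (h hq.pathCongruence hq.isOpen_pathCongruence))
    e.2

@[simp]
theorem liftCover_toCover (hq : IsCoveringMap q) (y₀ : Y) {x : X}
    (a : Path.Homotopic.Quotient (q y₀) x) :
    hq.liftCover y₀ ((core X).toCover a) = (hq.monodromy a ⟨y₀, rfl⟩).1 := rfl

theorem comp_liftCover (hq : IsCoveringMap q) (y₀ : Y) :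
    q ∘ hq.liftCover y₀ = (core X).proj (q y₀) := by
  funext e
  obtain ⟨y, a, rfl⟩ := exists_toCover e
  exact (hq.monodromy a ⟨y₀, rfl⟩).2

theorem continuous_liftCover (hq : IsCoveringMap q) (y₀ : Y) : Continuous (hq.liftCover y₀) := by
  refine continuous_of_toCover fun x a T hT => ?_
  have he : q (hq.monodromy a ⟨y₀, rfl⟩).1 = x := (hq.monodromy a ⟨y₀, rfl⟩).2
  obtain ⟨U, hU, hxU, h⟩ := hq.exists_section x
  obtain ⟨s, hs, hqs, hse, -⟩ := h U subset_rfl hU _ (he ▸ hxU)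
  rw [he] at hse
  rw [liftCover_toCover, ← hse] at hT
  have hU' := hU.mem_nhds hxU
  refine ⟨U ∩ s ⁻¹' T, inter_mem hU' (hs.continuousAt hU' hT), fun z δ hδ => ?_⟩
  rw [liftCover_toCover, hq.monodromy_trans_apply,
    hq.monodromy_section hs hqs δ (hδ.trans inter_subset_left) _ hse.symm]
  exact (hδ ⟨1, δ.target⟩).2

theorem surjective_liftCover [PathConnectedSpace Y] (hq : IsCoveringMap q) (y₀ : Y) :
    Function.Surjective (hq.liftCover y₀) := fun y =>
  ⟨(core X).toCover ((Path.Homotopic.Quotient.mk (PathConnectedSpace.somePath y₀ y)).map ⟨q, hq.continuous⟩),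
    congrArg Subtype.val (hq.monodromy_map _)⟩

end IsCoveringMap

/-- The covering space of the intersection of all open congruences is a universal covering as soon
as that intersection is open. -/
theorem PathCongruence.isUniversalCovering_proj {X : Type u} [TopologicalSpace X]
    [PathConnectedSpace X] [LocallyPathConnectedSpace X] (h : (core X).IsOpen) (x₀ : X) :
    IsUniversalCovering.{u, v, u} ((core X).proj x₀) := by
  have hp := isCoveringMap_proj (x₀ := x₀) h
  have hE := pathConnectedSpace_cover (core X) x₀
  refine ⟨⟨hp, surjective_proj⟩, hE, fun Y _ _ q hq => ⟨?_, ?_⟩⟩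
  · obtain ⟨y₀, rfl⟩ := hq.2 x₀
    have hf := hq.1.comp_liftCover y₀
    have hs := hq.1.surjective_liftCover y₀
    exact ⟨_, ⟨hq.1.of_comp (hf ▸ hp) (hq.1.continuous_liftCover y₀) hs, hs⟩, hf⟩
  · intro f₁ f₂ hf₁ hf₂ h₁ h₂
    -- This `e` lies over `x₀`, so it is the class of a loop `c`. The deck transformation of `c`
    -- moves the base point to `e`, and unique lifting does the rest.
    obtain ⟨e, he⟩ := hf₂.2 (f₁ ((core X).toCover (.refl x₀)))
    have hpe : (core X).proj x₀ e = x₀ := by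
      rw [← h₂, Function.comp_apply, he, ← Function.comp_apply (f := q), h₁, proj_toCover]
    obtain ⟨y, c, rfl⟩ := exists_toCover e
    obtain rfl : y = x₀ := hpe
    refine ⟨(core X).deck c, hq.1.eq_of_comp_eq (hf₂.1.continuous.comp (Homeomorph.continuous _))
      hf₁.1.continuous ?_ ((core X).toCover (.refl y)) ?_⟩
    · rw [← Function.comp_assoc, h₂, h₁]
      rfl
    · rw [← he]
      change f₂ ((core X).toCover (c.trans (.refl y))) = _
      rw [Path.Homotopic.Quotient.trans_refl]

theorem mainTheorem3 (X : Type u) [TopologicalSpace X] [ConnectedSpace X]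
    [LocallyPathConnectedSpace X] [FirstCountableTopology X] (x : X) :
    HasUniversalCovering.{u, v} X ∨ Uncountable (FundamentalGroup X x) := by
  have : PathConnectedSpace X := .of_locallyPathConnectedSpace
  by_cases h : (PathCongruence.core X).IsOpen
  · exact .inl ⟨_, _, _, PathCongruence.isUniversalCovering_proj h x⟩
  · obtain ⟨y, hy⟩ := PathCongruence.exists_uncountable_of_not_isOpen_core h
    exact .inr (FundamentalGroup.fundamentalGroupMulEquivOfPathConnected y x).injective.uncountable
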